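/- Let $M,N\ge 1$ be integers and $\eta>0$, $T_s>0$. Let $h_{r,t}(\cdot)$, $1\le r\le N$, $1\le t\le M$, be independent, identically distributed, zero-mean, wide-sense stationary, circularly symmetric complex Gaussian processes (Rayleigh fading) with $\mathbb E|h_{r,t}(s)|^2=1$ and common correlation coefficient $\rho_h(\tau)=\mathbb E[h_{r,t}(s)h_{r,t}^{*}(s-\tau)]$, and assume that $\varrho_1=|\rho_h(T_s)|<1$. The instantaneous mutual information (IMI) of the $M$-transmitter, $N$-receiver OSTBC-MIMO system is $$\mathcal I_l=\log_2\Big[1+\frac{\eta}{M}\sum_{r=1}^N\sum_{t=1}^M|h_{r,t}(lT_s)|^2\Big],\qquad l=1,2,\dots .$$ For a threshold $\mathcal I_{th}\ge 0$ let $X_l=1$ if $\mathcal I_l\ge\mathcal I_{th}$ and $X_l=0$ otherwise. Let $N_{\mathcal I}(\mathcal I_{th})$ be the level-crossing rate, i.e. the expected number of down-crossings per unit time, $$N_{\mathcal I}(\mathcal I_{th})=\frac{1}{(L-1)T_s}\,\mathbb E\big[\#\{2\le l\le L: X_{l-1}=1,\ X_l=0\}\big],\qquad L\ge2 .$$ Write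 $\Gamma(a,z)=\int_z^\infty t^{a-1}e^{-t}\,dt$ and $\gamma(a,z)=\int_0^z t^{a-1}e^{-t}\,dt$. Then, for every $L\ge 2$, $$N_{\mathcal I}(\mathcal I_{th})=\frac{\mathbb E\big[\sum_{l=2}^L(X_l-X_{l-1})^2\big]}{2(L-1)T_s}=\frac{\Pr\{X_l=1\}-\Pr\{X_l=1,X_{l-1}=1\}}{T_s}\quad(l\ge2),$$ and $$N_{\mathcal I}(\mathcal I_{th})=\frac{\Gamma\big(MN,\tfrac{M(2^{\mathcal I_{th}}-1)}{\eta}\big)}{(MN-1)!\,T_s}-\frac{(1-\varrho_1^2)^{MN}}{(MN-1)!\,T_s}\,S,\qquad S=\sum_{k=0}^\infty\frac{\varrho_1^{2k}\,\Gamma^2\big(k+MN,\tfrac{M(2^{\mathcal I_{th}}-1)}{\eta(1-\varrho_1^2)}\big)}{k!\,(MN+k-1)!},$$ where the series converges (with the convention $0^0=1$ if $\varrho_1=0$). If moreover $\mathcal I_{th}>0$, then $N_{\mathcal I}(\mathcal I_{th})>0$ and the average outage duration $\overline t_{\mathcal I}(\mathcal I_{th})=\Pr\{\mathcal I_l\le\mathcal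 I_{th}\}/N_{\mathcal I}(\mathcal I_{th})$, $l\ge1$, satisfies $$\frac{\overline t_{\mathcal I}(\mathcal I_{th})}{T_s}=\frac{\gamma\big(MN,\tfrac{M(2^{\mathcal I_{th}}-1)}{\eta}\big)}{\Gamma\big(MN,\tfrac{M(2^{\mathcal I_{th}}-1)}{\eta}\big)-(1-\varrho_1^2)^{MN}S}.$$ For $M=N=1$, $\mathcal I_l$ is the SISO IMI $\log_2(1+\eta|h(lT_s)|^2)$, where $h=h_{1,1}$, and the two formulas become $$N_{\mathcal I}(\mathcal I_{th})=\frac{e^{-(2^{\mathcal I_{th}}-1)/\eta}}{T_s}-\frac{1-\varrho_1^2}{T_s}S_1,\qquad \frac{\overline t_{\mathcal I}(\mathcal I_{th})}{T_s}=\frac{1-e^{-(2^{\mathcal I_{th}}-1)/\eta}}{e^{-(2^{\mathcal I_{th}}-1)/\eta}-(1-\varrho_1^2)S_1}\ \ (\mathcal I_{th}>0),$$ with $S_1=\sum_{k=0}^\infty\Big[\frac{\varrho_1^k}{k!}\Gamma\big(k+1,\tfrac{2^{\mathcal I_{th}}-1}{\eta(1-\varrho_1^2)}\big)\Big]^2$.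 -/

import Mathlib

open MeasureTheory ProbabilityTheory

noncomputable section

/-- The upper incomplete gamma function `Γ(a, z) = ∫_z^∞ t^(a-1) e^(-t) dt`. -/
def upperIncGamma (a z : ℝ) : ℝ := ∫ t in Set.Ioi z, t ^ (a - 1) * Real.exp (-t)

/-- The lower incomplete gamma function `γ(a, z) = ∫_0^z t^(a-1) e^(-t) dt`. -/
def lowerIncGamma (a z : ℝ) : ℝ := ∫ t in (0 : ℝ)..z, t ^ (a - 1) * Real.exp (-t)

/-- A unit-power Rayleigh fading process `h` with temporal correlation coefficient `ρ`: a zero-mean,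
wide-sense stationary, circularly symmetric complex Gaussian process such that
`E[h(t) h(t-τ)^*] = ρ(τ)` and `E[|h(t)|²] = ρ(0) = 1`. The real and imaginary parts are jointly
Gaussian (Gaussianity in `ℂ` viewed as a real vector space), and circular symmetry of a zero-mean
complex Gaussian process is the vanishing of `E[h(s) h(t)]`. -/
structure IsRayleighProcess {Ω : Type*} [MeasurableSpace Ω] (P : Measure Ω)
    (h : ℝ → Ω → ℂ) (ρ : ℝ → ℂ) : Prop where
  measurable : ∀ t, Measurable (h t)
  gaussian : IsGaussianProcess h P
  mean_zero : ∀ t, ∫ ω, h t ω ∂P = 0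
  correlation : ∀ t τ, ∫ ω, h t ω * (starRingEnd ℂ) (h (t - τ) ω) ∂P = ρ τ
  circular : ∀ s t, ∫ ω, h s ω * h t ω ∂P = 0
  unit_power : ρ 0 = 1

/-- A MIMO Rayleigh channel with `N` receive and `M` transmit antennas: the `N * M` subchannel
processes are mutually independent as random functions of time, and all of them are Rayleigh
processes with the same `ρ`; as `ρ` determines the law of such a process, they are identically
distributed. -/
structure IsRayleighMIMO {Ω : Type*} [MeasurableSpace Ω] (P : Measure Ω) {N M : ℕ}
    (h : Fin N → Fin M → ℝ → Ω → ℂ) (ρ : ℝ → ℂ) : Prop where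
  rayleigh : ∀ r t, IsRayleighProcess P (h r t) ρ
  indep : iIndepFun (fun (p : Fin N × Fin M) (ω : Ω) (s : ℝ) => h p.1 p.2 s ω) P

/-- SISO instantaneous mutual information at time `l * Ts`. -/
def sisoIMI {Ω : Type*} (η Ts : ℝ) (h : ℝ → Ω → ℂ) (l : ℕ) (ω : Ω) : ℝ :=
  Real.logb 2 (1 + η * ‖h (l * Ts) ω‖ ^ 2)

/-- OSTBC-MIMO instantaneous mutual information at time `l * Ts`. -/
def ostbcIMI {Ω : Type*} {N M : ℕ} (η Ts : ℝ) (h : Fin N → Fin M → ℝ → Ω → ℂ)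
    (l : ℕ) (ω : Ω) : ℝ :=
  Real.logb 2 (1 + η / M * ∑ r, ∑ t, ‖h r t (l * Ts) ω‖ ^ 2)

/-- The clipped binary sequence `X_l = 1` if `I_l ≥ θ`, and `X_l = 0` if `I_l < θ`. -/
def clip {Ω : Type*} (I : ℕ → Ω → ℝ) (θ : ℝ) (l : ℕ) (ω : Ω) : ℝ :=
  if θ ≤ I l ω then 1 else 0

/-- The number of up- and down-crossings of the level `θ` by `I_1, …, I_L`. -/
def crossings {Ω : Type*} (I : ℕ → Ω → ℝ) (θ : ℝ) (L : ℕ) (ω : Ω) : ℝ :=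
  ∑ l ∈ Finset.Icc 2 L, (clip I θ l ω - clip I θ (l - 1) ω) ^ 2

/-- The number of down-crossings of the level `θ` by `I_1, …, I_L`: the number of `l ∈ {2, …, L}`
with `X_{l-1} = 1` and `X_l = 0`. -/
def downCrossings {Ω : Type*} (I : ℕ → Ω → ℝ) (θ : ℝ) (L : ℕ) (ω : Ω) : ℝ :=
  ∑ l ∈ Finset.Icc 2 L, clip I θ (l - 1) ω * (1 - clip I θ l ω)

/-- The expected crossing rate (up- and down-crossings) on `Ts ≤ t ≤ L * Ts`. -/
def crossingRate {Ω : Type*} [MeasurableSpace Ω] (P : Measure Ω) (I : ℕ → Ω → ℝ)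
    (Ts θ : ℝ) (L : ℕ) : ℝ :=
  (∫ ω, crossings I θ L ω ∂P) / (((L : ℝ) - 1) * Ts)

/-- The level-crossing rate: the expected number of down-crossings of the level `θ` per unit time
on `Ts ≤ t ≤ L * Ts`. -/
def levelCrossingRate {Ω : Type*} [MeasurableSpace Ω] (P : Measure Ω) (I : ℕ → Ω → ℝ)
    (Ts θ : ℝ) (L : ℕ) : ℝ :=
  (∫ ω, downCrossings I θ L ω ∂P) / (((L : ℝ) - 1) * Ts)

/-- The average outage duration: the outage probability `P(I_l ≤ θ)` divided by the level-crossing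
rate. -/
def averageOutageDuration {Ω : Type*} [MeasurableSpace Ω] (P : Measure Ω) (I : ℕ → Ω → ℝ)
    (Ts θ : ℝ) (l L : ℕ) : ℝ :=
  P.real {ω | I l ω ≤ θ} / levelCrossingRate P I Ts θ L

end

/-! A down-crossing at `l` has indicator `X_{l-1}(1 - X_l)`, so by stationarity its mean is `p - J`,
with `p` and `J` the one- and two-sample exceedance probabilities. Everything else is the
computation of these two numbers.

Up to a threshold change, `p` and `J` concern the total channel power at one or two consecutive
sampling times. For a single subchannel, regressing one sample on the other
(`integral_cexp_norm_sq_pair`) gives the joint transform of the two squared moduli, `1/(1 - is - it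
- st(1 - ϱ²))`; independence raises it to the power `MN`. At `t = 0` this is the transform of a
gamma law of shape `MN`, which gives `p`. After division of both powers by `1 - ϱ²` it becomes `((1
- q)/((1 - is)(1 - it) - q))^{MN}` with `q = ϱ²`. Its expansion in powers of `q/((1 - is)(1 - it))`
exhibits a negative binomial mixture of products of two equal gamma laws
(`integral_cexp_gammaMixture`). By uniqueness of characteristic functions no joint density is
needed, and the series `S` is, up to a factor, the mass `J` of a quadrant under this mixture.

Positivity of the rate for `θ > 0` is `J < p`, which the `k = 0` component of the mixture already
forces (`gammaMixture_real_lt`). -/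

open scoped InnerProductSpace ComplexConjugate

/-! ### Gamma laws of integer shape and rate one. -/

/-- The Laplace transform of a monomial, at a complex frequency. -/
lemma integral_pow_mul_cexp_neg_mul_Ioi (n : ℕ) {b : ℂ} (hb : 0 < b.re) :
    IntegrableOn (fun t : ℝ => (t : ℂ) ^ n * Complex.exp (-b * t)) (Set.Ioi 0) ∧
    ∫ t in Set.Ioi (0 : ℝ), (t : ℂ) ^ n * Complex.exp (-b * t) = n.factorial / b ^ (n + 1) := by
  have hb0 : b ≠ 0 := by rintro rfl; simp at hb
  have hint : ∀ n : ℕ, IntegrableOn (fun t : ℝ => (t : ℂ) ^ n * Complex.exp (-b * t))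
      (Set.Ioi 0) := by
    intro n
    have h := integrableOn_rpow_mul_exp_neg_mul_rpow (s := n) (p := 1) (b := b.re)
      (by have : (0 : ℝ) ≤ n := n.cast_nonneg
          linarith) one_pos hb
    refine Integrable.mono' h (by fun_prop) ?_
    filter_upwards [ae_restrict_mem measurableSet_Ioi] with t ht
    have ht' : (0 : ℝ) < t := ht
    simp [Complex.norm_exp, abs_of_pos ht']
  refine ⟨hint n, ?_⟩
  induction n with
  | zero =>
    have := integral_exp_mul_complex_Ioi (a := -b) (by simpa using hb) 0
    simpa using this
  | succ n ih =>
    -- Integration by parts: this antiderivative vanishes at both `0` and `∞`, so the integral for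
    -- `n + 1` is `(n + 1)/b` times the one for `n`.
    have hderiv : ∀ x ∈ Set.Ici (0 : ℝ), HasDerivAt
        (fun t : ℝ => -((t : ℂ) ^ (n + 1) * Complex.exp (-b * t)) / b)
        ((x : ℂ) ^ (n + 1) * Complex.exp (-b * x) -
          ((n + 1) / b) * ((x : ℂ) ^ n * Complex.exp (-b * x))) x := by
      intro x _
      have h1 : HasDerivAt (fun z : ℂ => -(z ^ (n + 1) * Complex.exp (-b * z)) / b)
          ((x : ℂ) ^ (n + 1) * Complex.exp (-b * x) -
          ((n + 1) / b) * ((x : ℂ) ^ n * Complex.exp (-b * x))) (x : ℂ) := by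
        have h2 := (((hasDerivAt_pow (n + 1) (x : ℂ)).mul
          (((hasDerivAt_id (x : ℂ)).const_mul (-b)).cexp)).neg).div_const b
        convert! h2 using 1
        simp
        field_simp
        ring
      exact h1.comp_ofReal
    have hlim : Filter.Tendsto (fun t : ℝ => -((t : ℂ) ^ (n + 1) * Complex.exp (-b * t)) / b)
        Filter.atTop (nhds 0) := by
      have h0 := tendsto_rpow_mul_exp_neg_mul_atTop_nhds_zero (n + 1 : ℝ) b.re hb
      rw [tendsto_zero_iff_norm_tendsto_zero]
      have h3 := h0.div_const ‖b‖
      rw [zero_div] at h3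
      refine h3.congr' ?_
      filter_upwards [Filter.eventually_gt_atTop 0] with t ht
      have : t ^ ((n : ℝ) + 1) = t ^ (n + 1) := by exact_mod_cast Real.rpow_natCast t (n + 1)
      simp [Complex.norm_exp, abs_of_pos ht, this]
    have h := integral_Ioi_of_hasDerivAt_of_tendsto' hderiv
      ((hint (n + 1)).sub ((hint n).const_mul _)) hlim
    rw [integral_sub (hint (n + 1)) ((hint n).const_mul _), integral_const_mul, ih] at h
    simp only [Complex.ofReal_zero, ne_eq, Nat.add_eq_zero_iff, one_ne_zero, and_false,
      not_false_eq_true, zero_pow, zero_mul, neg_zero, zero_div, sub_zero, sub_eq_zero] at h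
    rw [h, Nat.factorial_succ]
    push_cast
    field_simp
    ring

lemma integral_gammaMeasure_one {E : Type*} [NormedAddCommGroup E] [NormedSpace ℝ E]
    (m : ℕ) (f : ℝ → E) :
    ∫ x, f x ∂(gammaMeasure (m + 1) 1) =
      ∫ x in Set.Ioi (0 : ℝ), (x ^ m * Real.exp (-x) / m.factorial) • f x := by
  have hpos : (0 : ℝ) < m + 1 := by positivity
  have hmeas : Measurable (gammaPDF (m + 1) 1) := (measurable_gammaPDFReal _ _).ennreal_ofReal
  rw [gammaMeasure, integral_withDensity_eq_integral_toReal_smul hmeas (by simp [gammaPDF]),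
    ← integral_Ici_eq_integral_Ioi, ← integral_indicator measurableSet_Ici]
  congr 1 with x
  rw [gammaPDF, ENNReal.toReal_ofReal (gammaPDFReal_nonneg hpos one_pos x), gammaPDFReal]
  by_cases hx : 0 ≤ x
  · simp [hx, Real.Gamma_nat_eq_factorial]
    congr 1
    ring
  · simp [hx]

instance (m : ℕ) : IsProbabilityMeasure (gammaMeasure ((m : ℝ) + 1) 1) :=
  isProbabilityMeasure_gammaMeasure (by positivity) one_pos

lemma integral_cexp_gammaMeasure_one (m : ℕ) (s : ℝ) :
    ∫ x, Complex.exp (Complex.I * (s * x)) ∂(gammaMeasure ((m : ℝ) + 1) 1) =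
      1 / (1 - Complex.I * s) ^ (m + 1) := by
  have h := (integral_pow_mul_cexp_neg_mul_Ioi m (b := 1 - Complex.I * s) (by simp)).2
  have hf : (m.factorial : ℂ) ≠ 0 := by exact_mod_cast m.factorial_ne_zero
  rw [integral_gammaMeasure_one]
  calc _ = ∫ x in Set.Ioi (0 : ℝ), (1 / (m.factorial : ℂ)) *
        ((x : ℂ) ^ m * Complex.exp (-(1 - Complex.I * s) * x)) := by
        congr 1 with x
        have : Complex.exp (-(1 - Complex.I * s) * x) =
          Complex.exp (-x) * Complex.exp (Complex.I * (s * x)) := by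
            rw [← Complex.exp_add]; ring_nf
        rw [this, Complex.real_smul]
        push_cast
        ring
    _ = _ := by
        rw [integral_const_mul, h]
        field_simp

lemma gammaMeasure_one_real (m : ℕ) {S : Set ℝ} (hS : MeasurableSet S) :
    (gammaMeasure ((m : ℝ) + 1) 1).real S =
      (∫ x in Set.Ioi (0 : ℝ) ∩ S, x ^ (m : ℝ) * Real.exp (-x)) / m.factorial := by
  rw [← integral_indicator_one hS, integral_gammaMeasure_one, ← setIntegral_indicator hS,
    ← integral_div]
  congr 1 with x
  by_cases hx : x ∈ S <;> simp [hx]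

lemma gammaMeasure_one_real_Ici (m : ℕ) {a : ℝ} (ha : 0 ≤ a) :
    (gammaMeasure ((m : ℝ) + 1) 1).real (Set.Ici a) =
      upperIncGamma ((m : ℝ) + 1) a / m.factorial := by
  rw [gammaMeasure_one_real m measurableSet_Ici, upperIncGamma, add_sub_cancel_right]
  congr 1
  apply setIntegral_congr_set
  refine Filter.EventuallyEq.trans ?_ Ioi_ae_eq_Ici.symm
  have : Set.Ici a = Set.Ici 0 ∩ Set.Ici a := by ext; simp; grind
  conv_rhs => rw [this]
  exact Ioi_ae_eq_Ici.inter (ae_eq_refl _)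

lemma gammaMeasure_one_real_Iic (m : ℕ) {a : ℝ} (ha : 0 ≤ a) :
    (gammaMeasure ((m : ℝ) + 1) 1).real (Set.Iic a) =
      lowerIncGamma ((m : ℝ) + 1) a / m.factorial := by
  rw [gammaMeasure_one_real m measurableSet_Iic, lowerIncGamma, add_sub_cancel_right,
    intervalIntegral.integral_of_le ha, Set.Ioi_inter_Iic]

lemma gammaMeasure_one_real_pos (m : ℕ) {a b : ℝ} (ha : 0 ≤ a) (hab : a < b) :
    0 < (gammaMeasure ((m : ℝ) + 1) 1).real (Set.Ioo a b) := by
  rw [gammaMeasure_one_real m measurableSet_Ioo]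
  have : Set.Ioi 0 ∩ Set.Ioo a b = Set.Ioo a b := by ext; simp; grind
  rw [this]
  refine div_pos ?_ (by positivity)
  rw [setIntegral_pos_iff_support_of_nonneg_ae]
  · refine lt_of_lt_of_le ?_ (measure_mono (s := Set.Ioo a b) fun x hx => ⟨?_, hx⟩)
    · simpa using hab
    · have : 0 < x := ha.trans_lt hx.1
      simp only [Function.mem_support]
      positivity
  · filter_upwards [ae_restrict_mem measurableSet_Ioo] with x hx
    have : 0 < x := ha.trans_lt hx.1
    simp only [Pi.zero_apply]
    positivity
  · refine IntegrableOn.mono_set ?_ (Set.Ioo_subset_Icc_self)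
    apply ContinuousOn.integrableOn_Icc
    have : (0 : ℝ) ≤ m := m.cast_nonneg
    exact ((Real.continuous_rpow_const this).mul (by fun_prop)).continuousOn

/-! ### The negative binomial mixture and its transform. -/

/-- The negative binomial weights. -/
noncomputable def negBinomialWeight (d : ℕ) (q : ℝ) (k : ℕ) : ℝ :=
  (1 - q) ^ (d + 1) * ((k + d).choose d * q ^ k)

lemma negBinomialWeight_nonneg (d : ℕ) {q : ℝ} (h0 : 0 ≤ q) (h1 : q < 1) (k : ℕ) :
    0 ≤ negBinomialWeight d q k := by
  have : 0 ≤ 1 - q := by linarith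
  unfold negBinomialWeight
  positivity

lemma hasSum_negBinomialWeight (d : ℕ) {q : ℝ} (h0 : 0 ≤ q) (h1 : q < 1) :
    HasSum (negBinomialWeight d q) 1 := by
  have h := (hasSum_choose_mul_geometric_of_norm_lt_one d
    (r := q) (by rwa [Real.norm_of_nonneg h0])).mul_left ((1 - q) ^ (d + 1))
  have : 1 - q ≠ 0 := by linarith
  rwa [mul_one_div_cancel (by positivity)] at h

/-- The negative binomial mixture of products of two gamma laws: the joint law of the normalized
powers of two correlated Rayleigh channels. -/
noncomputable def gammaMixture (d : ℕ) (q : ℝ) : Measure (ℝ × ℝ) :=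
  Measure.sum fun k : ℕ => ENNReal.ofReal (negBinomialWeight d q k) •
    (gammaMeasure ((d + k : ℕ) + 1) 1).prod (gammaMeasure ((d + k : ℕ) + 1) 1)

lemma hasSum_gammaMixture_real (d : ℕ) {q : ℝ} (h0 : 0 ≤ q) (h1 : q < 1)
    [IsFiniteMeasure (gammaMixture d q)] {A B : Set ℝ} (hA : MeasurableSet A) (hB : MeasurableSet B) :
    HasSum (fun k => negBinomialWeight d q k *
      ((gammaMeasure ((d + k : ℕ) + 1) 1).real A * (gammaMeasure ((d + k : ℕ) + 1) 1).real B))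
      ((gammaMixture d q).real (A ×ˢ B)) := by
  have hi : Integrable ((A ×ˢ B).indicator (1 : ℝ × ℝ → ℝ)) (gammaMixture d q) :=
    (integrable_const (1 : ℝ)).indicator (hA.prod hB)
  have h := hasSum_integral_measure hi
  rw [← gammaMixture, integral_indicator_one (hA.prod hB)] at h
  convert! h using 2 with k
  rw [integral_indicator_one (hA.prod hB), measureReal_ennreal_smul_apply, measureReal_prod_prod,
    ENNReal.toReal_ofReal (negBinomialWeight_nonneg d h0 h1 k)]

lemma isProbabilityMeasure_gammaMixture (d : ℕ) {q : ℝ} (h0 : 0 ≤ q) (h1 : q < 1) :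
    IsProbabilityMeasure (gammaMixture d q) := by
  constructor
  have h := hasSum_negBinomialWeight d h0 h1
  simp only [gammaMixture, Measure.sum_apply _ MeasurableSet.univ, Measure.smul_apply,
    measure_univ, smul_eq_mul, mul_one]
  rw [← ENNReal.ofReal_tsum_of_nonneg (negBinomialWeight_nonneg d h0 h1) h.summable, h.tsum_eq,
    ENNReal.ofReal_one]

/-- With `a = 1 - is` and `b = 1 - it`, component `k` contributes its weight times
`(ab)^{-(d+k+1)}`. Since `|ab| ≥ 1 > q`, this is a convergent negative binomial series in `q/(ab)`.
-/
lemma integral_cexp_gammaMixture (d : ℕ) {q : ℝ} (h0 : 0 ≤ q) (h1 : q < 1) (s t : ℝ) :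
    ∫ x, Complex.exp (Complex.I * (s * x.1 + t * x.2)) ∂(gammaMixture d q) =
      ((1 - q) / ((1 - Complex.I * s) * (1 - Complex.I * t) - q)) ^ (d + 1) := by
  have := isProbabilityMeasure_gammaMixture d h0 h1
  set a : ℂ := 1 - Complex.I * s with ha
  set b : ℂ := 1 - Complex.I * t with hb
  have hre : ∀ s : ℝ, 1 ≤ ‖1 - Complex.I * s‖ := fun s => by
    have := Complex.re_le_norm (1 - Complex.I * s)
    simpa using this
  have ha1 : 1 ≤ ‖a‖ := hre s
  have hb1 : 1 ≤ ‖b‖ := hre t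
  have ha0 : a ≠ 0 := norm_pos_iff.1 (by linarith)
  have hb0 : b ≠ 0 := norm_pos_iff.1 (by linarith)
  have hab : 1 ≤ ‖a * b‖ := by rw [norm_mul]; nlinarith
  have hi : Integrable (fun x : ℝ × ℝ => Complex.exp (Complex.I * (s * x.1 + t * x.2)))
      (gammaMixture d q) := by
    refine Integrable.of_bound (by fun_prop) 1 (Filter.Eventually.of_forall fun p => ?_)
    simp [Complex.norm_exp]
  have h := hasSum_integral_measure hi
  rw [← gammaMixture] at h
  have hq : ‖(q : ℂ) / (a * b)‖ < 1 := by
    rw [norm_div, div_lt_one (by linarith), Complex.norm_of_nonneg h0]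
    linarith
  have h2 := (hasSum_choose_mul_geometric_of_norm_lt_one d hq).mul_left
    ((1 - (q : ℂ)) ^ (d + 1) / (a * b) ^ (d + 1))
  have hne : a * b - q ≠ 0 := by
    intro h
    rw [sub_eq_zero] at h
    rw [h, Complex.norm_of_nonneg h0] at hab
    linarith
  refine h.unique ?_
  convert! h2 using 1
  · ext k
    have hprod := integral_prod_mul (μ := gammaMeasure ((d + k : ℕ) + 1) 1)
      (ν := gammaMeasure ((d + k : ℕ) + 1) 1) (fun x => Complex.exp (Complex.I * (s * x)))
      (fun x => Complex.exp (Complex.I * (t * x)))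
    simp_rw [← Complex.exp_add, ← mul_add] at hprod
    rw [integral_smul_measure, hprod, integral_cexp_gammaMeasure_one,
      integral_cexp_gammaMeasure_one, ← ha, ← hb,
      ENNReal.toReal_ofReal (negBinomialWeight_nonneg d h0 h1 k), negBinomialWeight,
      Complex.real_smul]
    push_cast
    simp only [div_pow, mul_pow]
    field_simp
    ring
  · rw [one_sub_div (mul_ne_zero ha0 hb0)]
    simp only [div_pow, mul_pow]
    field_simp

/-! ### Circular complex Gaussian laws. -/

/-- As `ℂ` has real dimension two, the Gaussian prefactor `(π/b)^{dim/2}` is `π/b`, with no branch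
of a root. -/
lemma integral_cexp_neg_mul_sq_norm_add_complex {b : ℂ} (hb : 0 < b.re) (c : ℂ) (w : ℂ) :
    ∫ v : ℂ, Complex.exp (-b * ‖v‖ ^ 2 + c * ⟪w, v⟫_ℝ) =
      Real.pi / b * Complex.exp (c ^ 2 * ‖w‖ ^ 2 / (4 * b)) := by
  rw [GaussianFourier.integral_cexp_neg_mul_sq_norm_add hb, Complex.finrank_real_complex]
  simp

/-- The circularly symmetric centred complex Gaussian law with mean square `τ`. -/
noncomputable def circularGaussian (τ : ℝ) : Measure ℂ :=
  volume.withDensity fun z => ENNReal.ofReal (Real.exp (-(‖z‖ ^ 2 / τ)) / (Real.pi * τ))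

lemma integral_circularGaussian {τ : ℝ} (hτ : 0 < τ) (f : ℂ → ℂ) :
    ∫ z, f z ∂(circularGaussian τ) =
      1 / (Real.pi * τ : ℂ) * ∫ z : ℂ, Complex.exp (-(1 / τ) * ‖z‖ ^ 2) * f z := by
  rw [circularGaussian, integral_withDensity_eq_integral_toReal_smul (by fun_prop) (by simp),
    ← integral_const_mul]
  congr 1 with z
  rw [ENNReal.toReal_ofReal (by positivity), Complex.real_smul]
  push_cast
  ring_nf

/-- The exponential integrals of a circular Gaussian. -/
lemma integral_cexp_circularGaussian {τ : ℝ} (hτ : 0 < τ) {β : ℂ} (hβ : β.re ≤ 0) (c w : ℂ) :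
    ∫ z, Complex.exp (β * ‖z‖ ^ 2 + c * ⟪w, z⟫_ℝ) ∂(circularGaussian τ) =
      1 / (1 - β * τ) * Complex.exp (c ^ 2 * ‖w‖ ^ 2 * τ / (4 * (1 - β * τ))) := by
  have hτ' : (τ : ℂ) ≠ 0 := by exact_mod_cast hτ.ne'
  have hre : 0 < (1 / (τ : ℂ) - β).re := by
    have : (1 / (τ : ℂ)).re = 1 / τ := by rw [← Complex.ofReal_one, ← Complex.ofReal_div]; rfl
    rw [Complex.sub_re, this]
    have : 0 < 1 / τ := by positivity
    linarith
  have hb0 : 1 / (τ : ℂ) - β ≠ 0 := fun h => by rw [h] at hre; simp at hre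
  have hb1 : 1 - β * τ ≠ 0 := by
    intro h
    apply hb0
    field_simp
    linear_combination h
  have h := integral_cexp_neg_mul_sq_norm_add_complex hre c w
  have hpi : (Real.pi : ℂ) ≠ 0 := by exact_mod_cast Real.pi_ne_zero
  rw [integral_circularGaussian hτ]
  calc _ = 1 / (Real.pi * τ : ℂ) *
      ∫ z : ℂ, Complex.exp (-(1 / (τ : ℂ) - β) * ‖z‖ ^ 2 + c * ⟪w, z⟫_ℝ) := by
        congr 2 with z
        rw [← Complex.exp_add]
        ring_nf
    _ = _ := by
        rw [h]
        have e : 1 / (τ : ℂ) - β = (1 - β * τ) / τ := by field_simp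
        rw [e]
        have : c ^ 2 * (‖w‖ : ℂ) ^ 2 / (4 * ((1 - β * τ) / τ)) =
          c ^ 2 * ‖w‖ ^ 2 * τ / (4 * (1 - β * τ)) := by field_simp
        rw [this]
        field_simp

lemma isProbabilityMeasure_circularGaussian {τ : ℝ} (hτ : 0 < τ) :
    IsProbabilityMeasure (circularGaussian τ) := by
  have h := integral_cexp_circularGaussian hτ (β := 0) (by simp) 0 0
  simp only [zero_mul, add_zero, Complex.exp_zero, integral_const] at h
  rw [isProbabilityMeasure_iff_real]
  simpa using h

/-! ### Squared moduli of a correlated Gaussian pair. -/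

section Gaussian

variable {Ω : Type*} [MeasurableSpace Ω] {P : Measure Ω}

/-- This is `Re A · Re B = Re(AB + A conj B)/2` for `A = conj x · Z` and `B = conj y · W`. It turns
the complex moments `E[ZW]` and `E[Z conj W]` into all the real covariances. -/
lemma integral_inner_mul_inner {Z W : Ω → ℂ} (hZ : MemLp Z 2 P) (hW : MemLp W 2 P) (x y : ℂ) :
    ∫ ω, ⟪x, Z ω⟫_ℝ * ⟪y, W ω⟫_ℝ ∂P =
      ((conj x * conj y * ∫ ω, Z ω * W ω ∂P) +
        (conj x * y * ∫ ω, Z ω * conj (W ω) ∂P)).re / 2 := by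
  have hW' : MemLp (fun ω => conj (W ω)) 2 P := hW.star
  have i1 : Integrable (fun ω => Z ω * W ω) P := hZ.integrable_mul hW
  have i2 : Integrable (fun ω => Z ω * conj (W ω)) P := hZ.integrable_mul hW'
  rw [← integral_const_mul, ← integral_const_mul, ← integral_add (i1.const_mul _) (i2.const_mul _)]
  have := integral_re ((i1.const_mul (conj x * conj y)).add (i2.const_mul (conj x * y)))
  simp only [RCLike.re_eq_complex_re, Pi.add_apply] at this
  rw [← this, ← integral_div]
  congr 1 with ω
  simp [Complex.inner]
  ring

/-- Because `E[Z²] = 0`, the variance of `⟪t, Z⟫` is `‖t‖² τ / 2`, so the characteristic function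
depends on `‖t‖` only. -/
lemma map_eq_circularGaussian [IsProbabilityMeasure P] {Z : Ω → ℂ} (hG : HasGaussianLaw Z P)
    (hm : ∫ ω, Z ω ∂P = 0) (hc : ∫ ω, Z ω * Z ω ∂P = 0) {τ : ℝ} (hτ : 0 < τ)
    (hv : ∫ ω, Z ω * conj (Z ω) ∂P = τ) : P.map Z = circularGaussian τ := by
  have := isProbabilityMeasure_circularGaussian hτ
  have := Measure.isProbabilityMeasure_map (μ := P) hG.aemeasurable
  apply Measure.ext_of_charFun
  ext t
  have hmean : ∫ ω, ⟪t, Z ω⟫_ℝ ∂P = 0 := by rw [integral_inner hG.integrable, hm, inner_zero_right]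
  rw [hG.charFun_map_eq, variance_of_integral_eq_zero (by have := hG.aemeasurable; fun_prop) hmean,
    hmean]
  have e1 := integral_inner_mul_inner hG.memLp_two hG.memLp_two t t
  have e2 : ∫ ω, ⟪t, Z ω⟫_ℝ ^ 2 ∂P = ‖t‖ ^ 2 * τ / 2 := by
    simp_rw [pow_two, e1, hc, hv]
    rw [Complex.conj_mul', mul_zero, zero_add]
    norm_cast
    rw [pow_two]
  rw [e2, charFun_apply]
  have e3 := integral_cexp_circularGaussian hτ (β := 0) (by simp) Complex.I t
  simp only [zero_mul, zero_add, sub_zero, Complex.I_sq] at e3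
  simp_rw [real_inner_comm t, mul_comm _ Complex.I]
  rw [e3]
  push_cast
  simp
  ring_nf

/-- The joint transform of the squared moduli of a pair of jointly Gaussian circular complex
variables. -/
lemma integral_cexp_norm_sq_pair [IsProbabilityMeasure P] {U V : Ω → ℂ}
    (hUm : Measurable U) (hVm : Measurable V)
    (hG : HasGaussianLaw (fun ω => (U ω, V ω)) P)
    (hU0 : ∫ ω, U ω ∂P = 0) (hV0 : ∫ ω, V ω ∂P = 0)
    (hUU : ∫ ω, U ω * U ω ∂P = 0) (hUV : ∫ ω, U ω * V ω ∂P = 0) (hVV : ∫ ω, V ω * V ω ∂P = 0)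
    (hU1 : ∫ ω, U ω * conj (U ω) ∂P = 1) (hV1 : ∫ ω, V ω * conj (V ω) ∂P = 1)
    {r : ℂ} (hr : ‖r‖ < 1) (hUVr : ∫ ω, U ω * conj (V ω) ∂P = r) (s t : ℝ) :
    ∫ ω, Complex.exp (Complex.I * (s * ‖U ω‖ ^ 2 + t * ‖V ω‖ ^ 2)) ∂P =
      1 / (1 - Complex.I * s - Complex.I * t - s * t * (1 - ‖r‖ ^ 2)) := by
  set τ : ℝ := 1 - ‖r‖ ^ 2 with hτdef
  have hτ : 0 < τ := by rw [hτdef]; nlinarith [norm_nonneg r]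
  -- The residual of the linear regression of `U` on `V`: the choice of `r` makes `E[W conj V] = 0`,
  -- circularity makes `E[WV] = 0`, and `τ` is the power of `W`.
  set W : Ω → ℂ := fun ω => U ω - r * V ω with hW
  have hWm : Measurable W := by fun_prop
  have hUL := hG.fst.memLp_two
  have hVL := hG.snd.memLp_two
  have hUcL : MemLp (fun ω => conj (U ω)) 2 P := hUL.star
  have hVcL : MemLp (fun ω => conj (V ω)) 2 P := hVL.star
  have hVU : ∫ ω, V ω * conj (U ω) ∂P = conj r := by
    rw [← hUVr, ← integral_conj]
    congr 1 with ω
    simp [mul_comm]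
  let Lin : ℂ × ℂ →L[ℝ] ℂ × ℂ :=
    ((ContinuousLinearMap.fst ℝ ℂ ℂ) - (ContinuousLinearMap.mul ℝ ℂ r).comp
      (ContinuousLinearMap.snd ℝ ℂ ℂ)).prod (ContinuousLinearMap.snd ℝ ℂ ℂ)
  have hGW : HasGaussianLaw (fun ω => (W ω, V ω)) P := hG.map_fun Lin
  have hWL := hGW.fst.memLp_two
  have iUU : Integrable (fun ω => U ω * U ω) P := hUL.integrable_mul hUL
  have iUV : Integrable (fun ω => U ω * V ω) P := hUL.integrable_mul hVL
  have iVV : Integrable (fun ω => V ω * V ω) P := hVL.integrable_mul hVL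
  have iUUc : Integrable (fun ω => U ω * conj (U ω)) P := hUL.integrable_mul hUcL
  have iUVc : Integrable (fun ω => U ω * conj (V ω)) P := hUL.integrable_mul hVcL
  have iVUc : Integrable (fun ω => V ω * conj (U ω)) P := hVL.integrable_mul hUcL
  have iVVc : Integrable (fun ω => V ω * conj (V ω)) P := hVL.integrable_mul hVcL
  have hW0 : ∫ ω, W ω ∂P = 0 := by
    rw [hW, integral_sub hG.fst.integrable (hG.snd.integrable.const_mul r), integral_const_mul,
      hU0, hV0]
    simp
  have hWV : ∫ ω, W ω * V ω ∂P = 0 := by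
    have : (fun ω => W ω * V ω) = fun ω => U ω * V ω - r * (V ω * V ω) := by
      ext ω; simp only [hW]; ring
    rw [this, integral_sub iUV (iVV.const_mul r), integral_const_mul, hUV, hVV]
    simp
  have hWVc : ∫ ω, W ω * conj (V ω) ∂P = 0 := by
    have : (fun ω => W ω * conj (V ω)) = fun ω => U ω * conj (V ω) - r * (V ω * conj (V ω)) := by
      ext ω; simp only [hW]; ring
    rw [this, integral_sub iUVc (iVVc.const_mul r), integral_const_mul, hUVr, hV1]
    simp
  have hWW : ∫ ω, W ω * W ω ∂P = 0 := by
    have : (fun ω => W ω * W ω) =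
        fun ω => U ω * U ω - 2 * r * (U ω * V ω) + r ^ 2 * (V ω * V ω) := by
      ext ω; simp only [hW]; ring
    have i1 : Integrable (fun ω => U ω * U ω - 2 * r * (U ω * V ω)) P := iUU.sub (iUV.const_mul _)
    rw [this, integral_add i1 (iVV.const_mul _),
      integral_sub iUU (iUV.const_mul _), integral_const_mul, integral_const_mul, hUU, hUV, hVV]
    simp
  have hWWc : ∫ ω, W ω * conj (W ω) ∂P = τ := by
    have : (fun ω => W ω * conj (W ω)) = fun ω => (U ω * conj (U ω) - conj r * (U ω * conj (V ω)))
        - (r * (V ω * conj (U ω)) - r * conj r * (V ω * conj (V ω))) := by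
      ext ω; simp only [hW, map_sub, map_mul]; ring
    have i1 : Integrable (fun ω => U ω * conj (U ω) - conj r * (U ω * conj (V ω))) P :=
      iUUc.sub (iUVc.const_mul _)
    have i2 : Integrable
        (fun ω => r * (V ω * conj (U ω)) - r * conj r * (V ω * conj (V ω))) P :=
      (iVUc.const_mul _).sub (iVVc.const_mul _)
    rw [this, integral_sub i1 i2, integral_sub iUUc (iUVc.const_mul _),
      integral_sub (iVUc.const_mul _) (iVVc.const_mul _), integral_const_mul, integral_const_mul,
      integral_const_mul, hU1, hUVr, hVU, hV1, mul_comm (conj r), Complex.mul_conj', hτdef]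
    push_cast
    ring
  -- For a jointly Gaussian pair, vanishing of all real covariances suffices; these involve both
  -- `E[WV]` and `E[W conj V]`.
  have hind : IndepFun W V P := by
    refine hGW.indepFun_of_covariance_inner fun x y => ?_
    have mx : ∫ ω, ⟪x, W ω⟫_ℝ ∂P = 0 := by
      rw [integral_inner hGW.fst.integrable, hW0, inner_zero_right]
    have my : ∫ ω, ⟪y, V ω⟫_ℝ ∂P = 0 := by
      rw [integral_inner hGW.snd.integrable, hV0, inner_zero_right]
    rw [covariance, mx, my]
    simp only [sub_zero]
    rw [integral_inner_mul_inner hWL hVL, hWV, hWVc]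
    simp
  have hmap : P.map (fun ω => (V ω, W ω)) = (circularGaussian 1).prod (circularGaussian τ) := by
    rw [(indepFun_iff_map_prod_eq_prod_map_map hVm.aemeasurable hWm.aemeasurable).1 hind.symm,
      map_eq_circularGaussian hGW.fst hW0 hWW hτ hWWc,
      map_eq_circularGaussian hGW.snd hV0 hVV one_pos (by simpa using hV1)]
  have := isProbabilityMeasure_circularGaussian hτ
  have := isProbabilityMeasure_circularGaussian one_pos
  let F : ℂ × ℂ → ℂ := fun p =>
    Complex.exp (Complex.I * (s * ‖p.2 + r * p.1‖ ^ 2 + t * ‖p.1‖ ^ 2))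
  have hFc : Continuous F := by fun_prop
  have hFi : Integrable F ((circularGaussian 1).prod (circularGaussian τ)) := by
    refine Integrable.of_bound hFc.aestronglyMeasurable 1 (Filter.Eventually.of_forall fun p => ?_)
    rw [Complex.norm_exp]
    simp [← Complex.ofReal_pow]
  have hsτ : 1 - Complex.I * s * τ ≠ 0 := fun h => by simpa using congrArg Complex.re h
  -- Integrate out the residual with `v` fixed. The cross term of `‖w + rv‖²` supplies the linear
  -- coefficient `2is`.
  have inner_int : ∀ v : ℂ, ∫ w, F (v, w) ∂(circularGaussian τ) =
      1 / (1 - Complex.I * s * τ) * Complex.exp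
        ((Complex.I * s * ‖r‖ ^ 2 / (1 - Complex.I * s * τ) + Complex.I * t) * ‖v‖ ^ 2) := by
    intro v
    have h := integral_cexp_circularGaussian hτ (β := Complex.I * s) (by simp)
      (2 * Complex.I * s) (r * v)
    have e : ∀ w, F (v, w) = Complex.exp (Complex.I * (s * ‖r * v‖ ^ 2 + t * ‖v‖ ^ 2)) *
        Complex.exp (Complex.I * s * ‖w‖ ^ 2 + 2 * Complex.I * s * ⟪r * v, w⟫_ℝ) := by
      intro w
      rw [← Complex.exp_add]
      simp only [F]
      congr 1
      have := norm_add_sq_real w (r * v)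
      rw [real_inner_comm] at this
      rw [← Complex.ofReal_pow, this]
      push_cast
      ring
    simp_rw [e]
    rw [integral_const_mul, h, mul_left_comm, ← Complex.exp_add]
    congr 2
    rw [norm_mul]
    push_cast
    field_simp
    ring
  -- What remains is a quadratic exponential in `v`; this sign lets it be integrated against
  -- `circularGaussian 1`.
  have hre : (Complex.I * s * ‖r‖ ^ 2 / (1 - Complex.I * s * τ) + Complex.I * t).re ≤ 0 := by
    have h2 : 0 ≤ s * ‖r‖ ^ 2 * (s * τ) := by
      have : 0 ≤ s ^ 2 * ‖r‖ ^ 2 * τ := by positivity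
      linarith
    rw [Complex.add_re, Complex.div_re]
    simp [← Complex.ofReal_pow]
    exact div_nonpos_of_nonpos_of_nonneg (by linarith) (Complex.normSq_nonneg _)
  calc _ = ∫ p, F p ∂(P.map (fun ω => (V ω, W ω))) := by
        rw [integral_map (by fun_prop) hFc.aestronglyMeasurable]
        simp [F, hW]
    _ = ∫ v, ∫ w, F (v, w) ∂(circularGaussian τ) ∂(circularGaussian 1) := by
        rw [hmap, integral_prod F hFi]
    _ = _ := by
        simp_rw [inner_int]
        rw [integral_const_mul]
        have h := integral_cexp_circularGaussian one_pos hre 0 0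
        simp only [zero_mul, add_zero] at h
        have hne : 1 - (Complex.I * s * ‖r‖ ^ 2 / (1 - Complex.I * s * τ) + Complex.I * t) ≠ 0 := by
          intro h0
          have h1 := congrArg Complex.re h0
          rw [Complex.sub_re, Complex.one_re, Complex.zero_re] at h1
          linarith
        rw [h]
        have hI : Complex.I ^ 2 = -1 := Complex.I_sq
        have hden : 1 - Complex.I * s - Complex.I * t - s * t * (1 - ‖r‖ ^ 2) =
            (1 - Complex.I * s * τ) *
              (1 - (Complex.I * s * ‖r‖ ^ 2 / (1 - Complex.I * s * τ) + Complex.I * t)) := by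
          rw [hτdef] at hsτ ⊢
          field_simp
          push_cast
          linear_combination (-(s : ℂ) * t * (1 - ‖r‖ ^ 2)) * hI
        rw [hden]
        simp [mul_comm]

end Gaussian

/-! ### Total power of independent subchannels. -/

section Law

variable {Ω : Type*} [MeasurableSpace Ω] {P : Measure Ω} [IsProbabilityMeasure P]
  {ι : Type*} [Fintype ι] {U V : ι → Ω → ℂ} {c : ℝ}

omit [IsProbabilityMeasure P] in
lemma integral_cexp_sum_norm_sq (hU : ∀ i, Measurable (U i)) (hV : ∀ i, Measurable (V i))
    (hind : iIndepFun (fun i ω => (U i ω, V i ω)) P)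
    (hchar : ∀ i, ∀ s t : ℝ, ∫ ω, Complex.exp (Complex.I * (s * ‖U i ω‖ ^ 2 + t * ‖V i ω‖ ^ 2)) ∂P =
      1 / (1 - Complex.I * s - Complex.I * t - s * t * (1 - c ^ 2))) (s t : ℝ) :
    ∫ ω, Complex.exp (Complex.I * (s * (∑ i, ‖U i ω‖ ^ 2 : ℝ) + t * (∑ i, ‖V i ω‖ ^ 2 : ℝ))) ∂P =
      (1 / (1 - Complex.I * s - Complex.I * t - s * t * (1 - c ^ 2))) ^ Fintype.card ι := by
  have h := hind.integral_fun_prod_comp (𝕜 := ℂ)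
    (f := fun _ (p : ℂ × ℂ) => Complex.exp (Complex.I * (s * ‖p.1‖ ^ 2 + t * ‖p.2‖ ^ 2)))
    (fun i => ((hU i).prodMk (hV i)).aemeasurable) (fun i => by
      have : Continuous (fun p : ℂ × ℂ =>
        Complex.exp (Complex.I * (s * ‖p.1‖ ^ 2 + t * ‖p.2‖ ^ 2))) := by fun_prop
      exact this.aestronglyMeasurable)
  simp only [hchar, Finset.prod_const, Finset.card_univ] at h
  rw [← h]
  congr 1 with ω
  rw [← Complex.exp_sum, ← Finset.mul_sum, Finset.sum_add_distrib, ← Finset.mul_sum,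
    ← Finset.mul_sum]
  push_cast
  rfl

/-- At `t = 0` the correlation `c` drops out of the pair transform, leaving `(1 - is)^{-(d+1)}`. -/
lemma map_sum_norm_sq_eq_gammaMeasure {d : ℕ} (hd : Fintype.card ι = d + 1)
    (hU : ∀ i, Measurable (U i)) (hV : ∀ i, Measurable (V i))
    (hind : iIndepFun (fun i ω => (U i ω, V i ω)) P)
    (hchar : ∀ i, ∀ s t : ℝ, ∫ ω, Complex.exp (Complex.I * (s * ‖U i ω‖ ^ 2 + t * ‖V i ω‖ ^ 2)) ∂P =
      1 / (1 - Complex.I * s - Complex.I * t - s * t * (1 - c ^ 2))) :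
    P.map (fun ω => ∑ i, ‖U i ω‖ ^ 2) = gammaMeasure (d + 1) 1 := by
  have hm : Measurable (fun ω => ∑ i, ‖U i ω‖ ^ 2) := by fun_prop
  have := Measure.isProbabilityMeasure_map (μ := P) hm.aemeasurable
  apply Measure.ext_of_charFun
  ext s
  have h := integral_cexp_sum_norm_sq hU hV hind hchar s 0
  rw [charFun_apply_real, charFun_apply_real, integral_map hm.aemeasurable (by fun_prop)]
  have h2 := integral_cexp_gammaMeasure_one d s
  simp_rw [mul_comm Complex.I] at h h2
  rw [h2]
  simp only [Complex.ofReal_zero, zero_mul, mul_zero, add_zero, sub_zero] at h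
  rw [h, hd, div_pow, one_pow]

/-- Dividing the powers by `1 - c²` evaluates their transform at `s/(1 - c²)` and `t/(1 - c²)`,
which clears the coefficient of `st` and produces the transform of the mixture. -/
lemma map_sum_norm_sq_pair_eq_gammaMixture {d : ℕ} (hd : Fintype.card ι = d + 1)
    (hU : ∀ i, Measurable (U i)) (hV : ∀ i, Measurable (V i))
    (hind : iIndepFun (fun i ω => (U i ω, V i ω)) P) (h0 : 0 ≤ c) (h1 : c < 1)
    (hchar : ∀ i, ∀ s t : ℝ, ∫ ω, Complex.exp (Complex.I * (s * ‖U i ω‖ ^ 2 + t * ‖V i ω‖ ^ 2)) ∂P =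
      1 / (1 - Complex.I * s - Complex.I * t - s * t * (1 - c ^ 2))) :
    P.map (fun ω => ((∑ i, ‖U i ω‖ ^ 2) / (1 - c ^ 2), (∑ i, ‖V i ω‖ ^ 2) / (1 - c ^ 2))) =
      gammaMixture d (c ^ 2) := by
  have hm : Measurable (fun ω => ((∑ i, ‖U i ω‖ ^ 2) / (1 - c ^ 2),
    (∑ i, ‖V i ω‖ ^ 2) / (1 - c ^ 2))) := by fun_prop
  have hc : c ^ 2 < 1 := by nlinarith
  have := Measure.isProbabilityMeasure_map (μ := P) hm.aemeasurable
  have := isProbabilityMeasure_gammaMixture d (sq_nonneg c) hc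
  -- The product `ℝ × ℝ` carries the sup norm, so frequencies are continuous functionals `L`,
  -- recorded by their values `s` and `t` on the basis vectors.
  apply Measure.ext_of_charFunDual
  ext L
  set s := L (1, 0) with hs
  set t := L (0, 1) with ht
  have hL : ∀ p : ℝ × ℝ, L p = s * p.1 + t * p.2 := by
    intro p
    have : p = p.1 • ((1, 0) : ℝ × ℝ) + p.2 • ((0, 1) : ℝ × ℝ) := by ext <;> simp
    conv_lhs => rw [this, map_add, map_smul, map_smul]
    simp [hs, ht, mul_comm]
  have hσ : (1 : ℝ) - c ^ 2 ≠ 0 := by linarith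
  have hσ' : (1 : ℂ) - c ^ 2 ≠ 0 := by exact_mod_cast hσ
  have h := integral_cexp_sum_norm_sq hU hV hind hchar (s / (1 - c ^ 2)) (t / (1 - c ^ 2))
  have h2 := integral_cexp_gammaMixture d (sq_nonneg c) hc s t
  rw [charFunDual_apply, charFunDual_apply, integral_map hm.aemeasurable (by fun_prop)]
  simp_rw [hL, mul_comm _ Complex.I]
  push_cast at h h2 ⊢
  rw [h2]
  calc _ = _ := by
        congr 1 with ω
        congr 1
        ring
    _ = _ := h
    _ = _ := by
        rw [hd]
        congr 1
        have hI : Complex.I ^ 2 = -1 := Complex.I_sq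
        have e : (1 - Complex.I * s) * (1 - Complex.I * t) - (c : ℂ) ^ 2 =
          (1 - c ^ 2) * (1 - Complex.I * (s / (1 - c ^ 2)) - Complex.I * (t / (1 - c ^ 2)) -
            s / (1 - c ^ 2) * (t / (1 - c ^ 2)) * (1 - c ^ 2)) := by
          field_simp
          linear_combination (s : ℂ) * t * hI
        rw [e, div_mul_eq_div_div, div_self hσ']

end Law

/-! ### Power laws of the Rayleigh MIMO channel. -/

section Rayleigh

variable {Ω : Type*} [MeasurableSpace Ω] {P : Measure Ω} [IsProbabilityMeasure P]

lemma IsRayleighProcess.integral_cexp_norm_sq {h : ℝ → Ω → ℂ} {ρ : ℝ → ℂ}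
    (hh : IsRayleighProcess P h ρ) {τ : ℝ} (hρ : ‖ρ τ‖ < 1) (x s t : ℝ) :
    ∫ ω, Complex.exp (Complex.I * (s * ‖h x ω‖ ^ 2 + t * ‖h (x - τ) ω‖ ^ 2)) ∂P =
      1 / (1 - Complex.I * s - Complex.I * t - s * t * (1 - ‖ρ τ‖ ^ 2)) := by
  have hu : ∀ x, ∫ ω, h x ω * conj (h x ω) ∂P = 1 := fun x => by
    simpa [hh.unit_power] using hh.correlation x 0
  exact integral_cexp_norm_sq_pair (hh.measurable _) (hh.measurable _)
    hh.gaussian.hasGaussianLaw_prodMk (hh.mean_zero _) (hh.mean_zero _) (hh.circular _ _)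
    (hh.circular _ _) (hh.circular _ _) (hu _) (hu _) hρ (hh.correlation x τ) s t

variable {M N : ℕ} {h : Fin N → Fin M → ℝ → Ω → ℂ} {ρ : ℝ → ℂ}

/-- The delay `τ` is auxiliary: the one-sample law is read off as a marginal of the pair at `x` and
`x - τ`. -/
lemma IsRayleighMIMO.map_power_eq_gammaMeasure (hh : IsRayleighMIMO P h ρ) {d : ℕ}
    (hd : M * N = d + 1) {τ : ℝ} (hρ : ‖ρ τ‖ < 1) (x : ℝ) :
    P.map (fun ω => ∑ r, ∑ t, ‖h r t x ω‖ ^ 2) = gammaMeasure (d + 1) 1 := by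
  have key := map_sum_norm_sq_eq_gammaMeasure (ι := Fin N × Fin M) (P := P)
    (U := fun p => h p.1 p.2 x) (V := fun p => h p.1 p.2 (x - τ)) (d := d)
    (by simp [← hd, mul_comm]) (fun p => (hh.rayleigh _ _).measurable _)
    (fun p => (hh.rayleigh _ _).measurable _)
    -- Independence as random functions of time passes to the pairs of samples by evaluation at two
    -- instants.
    (hh.indep.comp (fun _ f => (f x, f (x - τ))) (fun _ => by fun_prop))
    (fun p s t => (hh.rayleigh p.1 p.2).integral_cexp_norm_sq hρ x s t)
  simpa only [Fintype.sum_prod_type] using key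

lemma IsRayleighMIMO.map_power_pair_eq_gammaMixture (hh : IsRayleighMIMO P h ρ) {d : ℕ}
    (hd : M * N = d + 1) {τ : ℝ} (hρ : ‖ρ τ‖ < 1) (x : ℝ) :
    P.map (fun ω => ((∑ r, ∑ t, ‖h r t x ω‖ ^ 2) / (1 - ‖ρ τ‖ ^ 2),
      (∑ r, ∑ t, ‖h r t (x - τ) ω‖ ^ 2) / (1 - ‖ρ τ‖ ^ 2))) = gammaMixture d (‖ρ τ‖ ^ 2) := by
  have key := map_sum_norm_sq_pair_eq_gammaMixture (ι := Fin N × Fin M) (P := P)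
    (U := fun p => h p.1 p.2 x) (V := fun p => h p.1 p.2 (x - τ)) (d := d)
    (by simp [← hd, mul_comm]) (fun p => (hh.rayleigh _ _).measurable _)
    (fun p => (hh.rayleigh _ _).measurable _)
    (hh.indep.comp (fun _ f => (f x, f (x - τ))) (fun _ => by fun_prop)) (norm_nonneg _) hρ
    (fun p s t => (hh.rayleigh p.1 p.2).integral_cexp_norm_sq hρ x s t)
  simpa only [Fintype.sum_prod_type] using key

end Rayleigh

/-! ### Expected crossings from one- and two-sample probabilities. -/

section Crossings

variable {Ω : Type*} [MeasurableSpace Ω] {P : Measure Ω} [IsProbabilityMeasure P]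
  {I : ℕ → Ω → ℝ} {θ p J : ℝ}

omit [MeasurableSpace Ω] in
lemma clip_eq_one_iff (l : ℕ) (ω : Ω) : clip I θ l ω = 1 ↔ θ ≤ I l ω := by
  simp [clip]

lemma integrable_clip (hI : ∀ l, Measurable (I l)) (l : ℕ) : Integrable (clip I θ l) P := by
  have : clip I θ l = {ω | θ ≤ I l ω}.indicator (fun _ => 1) := by
    ext ω; simp [clip, Set.indicator]
  rw [this]
  exact (integrable_const 1).indicator (measurableSet_le measurable_const (hI l))

omit [IsProbabilityMeasure P] in
lemma integral_clip (hI : ∀ l, Measurable (I l)) (l : ℕ) :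
    ∫ ω, clip I θ l ω ∂P = P.real {ω | clip I θ l ω = 1} := by
  simp_rw [clip_eq_one_iff]
  rw [← integral_indicator_one (measurableSet_le measurable_const (hI l))]
  rfl

lemma integrable_clip_mul_clip (hI : ∀ l, Measurable (I l)) (l m : ℕ) :
    Integrable (fun ω => clip I θ l ω * clip I θ m ω) P := by
  refine (integrable_clip (θ := θ) hI l).mul_bdd (c := 1)
    (integrable_clip (P := P) hI m).aestronglyMeasurable
    (Filter.Eventually.of_forall fun ω => ?_)
  unfold clip
  split_ifs <;> simp

omit [IsProbabilityMeasure P] in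
lemma integral_clip_mul_clip (hI : ∀ l, Measurable (I l)) (l m : ℕ) :
    ∫ ω, clip I θ l ω * clip I θ m ω ∂P =
      P.real {ω | clip I θ l ω = 1 ∧ clip I θ m ω = 1} := by
  simp_rw [clip_eq_one_iff]
  have hm : MeasurableSet {ω | θ ≤ I l ω ∧ θ ≤ I m ω} :=
    (measurableSet_le measurable_const (hI l)).inter (measurableSet_le measurable_const (hI m))
  rw [← integral_indicator_one hm]
  congr 1 with ω
  by_cases h1 : θ ≤ I l ω <;> by_cases h2 : θ ≤ I m ω <;> simp [clip, h1, h2]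

/-- Of stationarity only the independence of `p` and `J` from `l` is used: each of the `L - 1`
summands then has mean `p - J`. -/
lemma integral_downCrossings (hI : ∀ l, Measurable (I l))
    (hp : ∀ l, 1 ≤ l → P.real {ω | clip I θ l ω = 1} = p)
    (hJ : ∀ l, 2 ≤ l → P.real {ω | clip I θ l ω = 1 ∧ clip I θ (l - 1) ω = 1} = J)
    {L : ℕ} (hL : 2 ≤ L) :
    ∫ ω, downCrossings I θ L ω ∂P = ((L : ℝ) - 1) * (p - J) := by
  have e : ∀ l ω, clip I θ (l - 1) ω * (1 - clip I θ l ω) =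
      clip I θ (l - 1) ω - clip I θ l ω * clip I θ (l - 1) ω := fun l ω => by ring
  have i1 : ∀ l, Integrable
      (fun ω => clip I θ (l - 1) ω - clip I θ l ω * clip I θ (l - 1) ω) P :=
    fun l => (integrable_clip hI (l - 1)).sub (integrable_clip_mul_clip hI l (l - 1))
  simp only [downCrossings, e]
  rw [integral_finsetSum _ fun l _ => i1 l,
    Finset.sum_congr rfl (g := fun _ => p - J), Finset.sum_const, Nat.card_Icc, nsmul_eq_mul,
    show L + 1 - 2 = L - 1 by omega, Nat.cast_sub (by omega), Nat.cast_one]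
  intro l hl
  have hl2 := (Finset.mem_Icc.1 hl).1
  rw [integral_sub (integrable_clip hI (l - 1)) (integrable_clip_mul_clip hI l (l - 1)),
    integral_clip hI, integral_clip_mul_clip hI, hJ l hl2, hp _ (by omega)]

lemma integral_crossings (hI : ∀ l, Measurable (I l))
    (hp : ∀ l, 1 ≤ l → P.real {ω | clip I θ l ω = 1} = p)
    (hJ : ∀ l, 2 ≤ l → P.real {ω | clip I θ l ω = 1 ∧ clip I θ (l - 1) ω = 1} = J)
    {L : ℕ} (hL : 2 ≤ L) :
    ∫ ω, crossings I θ L ω ∂P = ((L : ℝ) - 1) * (2 * (p - J)) := by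
  -- A clipped value equals its own square.
  have e : ∀ l ω, (clip I θ l ω - clip I θ (l - 1) ω) ^ 2 =
      (clip I θ l ω + clip I θ (l - 1) ω) - 2 * (clip I θ l ω * clip I θ (l - 1) ω) :=
    fun l ω => by unfold clip; split_ifs <;> norm_num
  have i1 : ∀ l, Integrable (fun ω => clip I θ l ω + clip I θ (l - 1) ω) P :=
    fun l => (integrable_clip hI l).add (integrable_clip hI (l - 1))
  have i2 : ∀ l, Integrable (fun ω => 2 * (clip I θ l ω * clip I θ (l - 1) ω)) P :=
    fun l => (integrable_clip_mul_clip hI l (l - 1)).const_mul 2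
  have i3 : ∀ l, Integrable (fun ω => clip I θ l ω + clip I θ (l - 1) ω -
      2 * (clip I θ l ω * clip I θ (l - 1) ω)) P := fun l => (i1 l).sub (i2 l)
  simp only [crossings, e]
  rw [integral_finsetSum _ fun l _ => i3 l,
    Finset.sum_congr rfl (g := fun _ => 2 * (p - J)), Finset.sum_const, Nat.card_Icc,
    nsmul_eq_mul, show L + 1 - 2 = L - 1 by omega, Nat.cast_sub (by omega), Nat.cast_one]
  intro l hl
  have hl2 := (Finset.mem_Icc.1 hl).1
  rw [integral_sub (i1 l) (i2 l), integral_add (integrable_clip hI l) (integrable_clip hI (l - 1)),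
    integral_const_mul, integral_clip hI, integral_clip hI, integral_clip_mul_clip hI, hJ l hl2,
    hp _ (by omega), hp _ (by omega)]
  ring

end Crossings

lemma upperIncGamma_one (z : ℝ) : upperIncGamma 1 z = Real.exp (-z) := by
  simp [upperIncGamma, integral_exp_Iic]

lemma lowerIncGamma_one (z : ℝ) : lowerIncGamma 1 z = 1 - Real.exp (-z) := by
  simp [lowerIncGamma]

/-! ### Quadrant masses of the mixture. -/

section Mixture

/-- The binomial weight `(k+d)!/(k! d!)` meets `(Γ(d+k+1, z)/(d+k)!)²`: one factor `(d+k)!` cancels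
and `1/d!` moves to the prefactor. -/
lemma hasSum_gammaMixture_Ici (d : ℕ) {c : ℝ} (h0 : 0 ≤ c) (h1 : c < 1) {z : ℝ} (hz : 0 ≤ z) :
    HasSum (fun k : ℕ => (1 - c ^ 2) ^ (d + 1) / d.factorial * (c ^ (2 * k) *
      upperIncGamma ((k : ℝ) + (d + 1)) z ^ 2 / (k.factorial * (d + 1 + k - 1).factorial)))
      ((gammaMixture d (c ^ 2)).real (Set.Ici z ×ˢ Set.Ici z)) := by
  have hc : c ^ 2 < 1 := by nlinarith
  have := isProbabilityMeasure_gammaMixture d (sq_nonneg c) hc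
  have h := hasSum_gammaMixture_real d (sq_nonneg c) hc (measurableSet_Ici (a := z))
    (measurableSet_Ici (a := z))
  convert! h using 2 with k
  rw [gammaMeasure_one_real_Ici _ hz, negBinomialWeight, Nat.cast_choose ℝ (Nat.le_add_left d k),
    show d + 1 + k - 1 = k + d by omega, Nat.add_sub_cancel, add_comm d k, pow_mul]
  push_cast
  rw [add_assoc]
  field_simp

/-- The two masses differ by that of `[z, ∞) × (-∞, z)`. The `k = 0` component charges it, with
weight `(1 - q)^{d+1}`, positive even if `q = 0`; `z > 0` is needed because gamma laws live on the
positive half-line. -/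
lemma gammaMixture_real_lt (d : ℕ) {q : ℝ} (h0 : 0 ≤ q) (h1 : q < 1) {z : ℝ} (hz : 0 < z) :
    (gammaMixture d q).real (Set.Ici z ×ˢ Set.Ici z) <
      (gammaMixture d q).real (Set.Ici z ×ˢ Set.univ) := by
  have := isProbabilityMeasure_gammaMixture d h0 h1
  have hunion : (Set.Ici z ×ˢ Set.univ : Set (ℝ × ℝ)) =
      Set.Ici z ×ˢ Set.Ici z ∪ Set.Ici z ×ˢ Set.Iio z := by
    rw [← Set.prod_union, Set.Ici_union_Iio]
  have hdisj : Disjoint (Set.Ici z ×ˢ Set.Ici z : Set (ℝ × ℝ)) (Set.Ici z ×ˢ Set.Iio z) :=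
    Set.Disjoint.set_prod_right
      (Set.disjoint_left.2 fun x (hx : z ≤ x) (hx' : x < z) => not_lt.2 hx hx') _ _
  rw [hunion, measureReal_union hdisj (measurableSet_Ici.prod measurableSet_Iio)]
  have h := hasSum_gammaMixture_real d h0 h1 (measurableSet_Ici (a := z))
    (measurableSet_Iio (a := z))
  have hle := h.summable.le_tsum 0 fun k _ =>
    mul_nonneg (negBinomialWeight_nonneg d h0 h1 k) (by positivity)
  rw [h.tsum_eq] at hle
  have hw : 0 < negBinomialWeight d q 0 := by
    have : 0 < 1 - q := by linarith
    simp only [negBinomialWeight, zero_add, Nat.choose_self, pow_zero]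
    positivity
  have hA := (gammaMeasure_one_real_pos (d + 0) hz.le (lt_add_one z)).trans_le
    (measureReal_mono (Set.Ioo_subset_Ico_self.trans Set.Ico_subset_Ici_self))
  have hB := (gammaMeasure_one_real_pos (d + 0) le_rfl hz).trans_le
    (measureReal_mono Set.Ioo_subset_Iio_self)
  have := mul_pos hw (mul_pos hA hB)
  linarith

end Mixture

/-! ### From mutual information to power thresholds. -/

section Threshold

variable {Ω : Type*} {M N : ℕ} {η Ts θ : ℝ} {h : Fin N → Fin M → ℝ → Ω → ℂ}

lemma le_ostbcIMI_iff (hM : 1 ≤ M) (hη : 0 < η) (l : ℕ) (ω : Ω) :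
    θ ≤ ostbcIMI η Ts h l ω ↔ M * (2 ^ θ - 1) / η ≤ ∑ r, ∑ t, ‖h r t (l * Ts) ω‖ ^ 2 := by
  have hM' : (0 : ℝ) < M := by exact_mod_cast hM
  have hpos : 0 < 1 + η / M * ∑ r, ∑ t, ‖h r t (l * Ts) ω‖ ^ 2 := by positivity
  rw [ostbcIMI, Real.le_logb_iff_rpow_le one_lt_two hpos, div_le_iff₀ hη, div_mul_eq_mul_div,
    ← sub_le_iff_le_add', le_div_iff₀ hM', mul_comm (2 ^ θ - 1) (M : ℝ), mul_comm η]

lemma ostbcIMI_le_iff (hM : 1 ≤ M) (hη : 0 < η) (l : ℕ) (ω : Ω) :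
    ostbcIMI η Ts h l ω ≤ θ ↔ ∑ r, ∑ t, ‖h r t (l * Ts) ω‖ ^ 2 ≤ M * (2 ^ θ - 1) / η := by
  have hM' : (0 : ℝ) < M := by exact_mod_cast hM
  have hpos : 0 < 1 + η / M * ∑ r, ∑ t, ‖h r t (l * Ts) ω‖ ^ 2 := by positivity
  rw [ostbcIMI, Real.logb_le_iff_le_rpow one_lt_two hpos, le_div_iff₀ hη, div_mul_eq_mul_div,
    ← le_sub_iff_add_le', div_le_iff₀ hM', mul_comm (2 ^ θ - 1) (M : ℝ), mul_comm η]

lemma ostbcIMI_eq_sisoIMI {h : Fin 1 → Fin 1 → ℝ → Ω → ℂ} (r t : Fin 1) :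
    ostbcIMI η Ts h = sisoIMI η Ts (h r t) := by
  funext l ω
  simp [ostbcIMI, sisoIMI, Subsingleton.elim r 0, Subsingleton.elim t 0]

end Threshold

/-! ### Assembly of the rate, the outage duration and the SISO case. -/

theorem mainTheorem4 {Ω : Type*} [MeasurableSpace Ω] (P : Measure Ω) [IsProbabilityMeasure P]
    (M N : ℕ) (hM : 1 ≤ M) (hN : 1 ≤ N) (η Ts : ℝ) (hη : 0 < η) (hTs : 0 < Ts)
    (h : Fin N → Fin M → ℝ → Ω → ℂ) (ρ : ℝ → ℂ) (hh : IsRayleighMIMO P h ρ)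
    (ϱ : ℝ) (hϱ : ϱ = ‖ρ Ts‖) (hϱ_lt : ϱ < 1) (θ : ℝ) (hθ : 0 ≤ θ) :
    -- the series converges
    Summable (fun k : ℕ => ϱ ^ (2 * k) *
      upperIncGamma ((k : ℝ) + M * N) (M * (2 ^ θ - 1) / (η * (1 - ϱ ^ 2))) ^ 2 /
        (k.factorial * (M * N + k - 1).factorial)) ∧
    -- the level-crossing rate, over any number `L ≥ 2` of samples
    (∀ L : ℕ, 2 ≤ L →
      levelCrossingRate P (ostbcIMI η Ts h) Ts θ L =
        upperIncGamma (M * N) (M * (2 ^ θ - 1) / η) / ((M * N - 1).factorial * Ts) -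
        (1 - ϱ ^ 2) ^ (M * N) / ((M * N - 1).factorial * Ts) *
          ∑' k : ℕ, ϱ ^ (2 * k) *
            upperIncGamma ((k : ℝ) + M * N) (M * (2 ^ θ - 1) / (η * (1 - ϱ ^ 2))) ^ 2 /
              (k.factorial * (M * N + k - 1).factorial)) ∧
    -- it is half of the total expected crossing rate
    (∀ L : ℕ, 2 ≤ L →
      crossingRate P (ostbcIMI η Ts h) Ts θ L =
        2 * levelCrossingRate P (ostbcIMI η Ts h) Ts θ L) ∧
    -- and it is given by the one- and two-sample exceedance probabilities
    (∀ l L : ℕ, 2 ≤ l → 2 ≤ L →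
      levelCrossingRate P (ostbcIMI η Ts h) Ts θ L =
        (P.real {ω | clip (ostbcIMI η Ts h) θ l ω = 1} -
          P.real {ω | clip (ostbcIMI η Ts h) θ l ω = 1 ∧
            clip (ostbcIMI η Ts h) θ (l - 1) ω = 1}) / Ts) ∧
    -- the average outage duration
    (0 < θ → ∀ l L : ℕ, 1 ≤ l → 2 ≤ L →
      0 < levelCrossingRate P (ostbcIMI η Ts h) Ts θ L ∧
      averageOutageDuration P (ostbcIMI η Ts h) Ts θ l L / Ts =
        lowerIncGamma (M * N) (M * (2 ^ θ - 1) / η) /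
          (upperIncGamma (M * N) (M * (2 ^ θ - 1) / η) -
            (1 - ϱ ^ 2) ^ (M * N) *
              ∑' k : ℕ, ϱ ^ (2 * k) *
                upperIncGamma ((k : ℝ) + M * N) (M * (2 ^ θ - 1) / (η * (1 - ϱ ^ 2))) ^ 2 /
                  (k.factorial * (M * N + k - 1).factorial))) ∧
    -- reduction to the SISO case
    (M = 1 → N = 1 → ∀ (r : Fin N) (t : Fin M),
      ostbcIMI η Ts h = sisoIMI η Ts (h r t) ∧
      (∀ L : ℕ, 2 ≤ L →
        levelCrossingRate P (sisoIMI η Ts (h r t)) Ts θ L =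
          Real.exp (-((2 ^ θ - 1) / η)) / Ts -
          (1 - ϱ ^ 2) / Ts * ∑' k : ℕ, (ϱ ^ k / k.factorial *
            upperIncGamma ((k : ℝ) + 1) ((2 ^ θ - 1) / (η * (1 - ϱ ^ 2)))) ^ 2) ∧
      (0 < θ → ∀ l L : ℕ, 1 ≤ l → 2 ≤ L →
        averageOutageDuration P (sisoIMI η Ts (h r t)) Ts θ l L / Ts =
          (1 - Real.exp (-((2 ^ θ - 1) / η))) /
            (Real.exp (-((2 ^ θ - 1) / η)) -
              (1 - ϱ ^ 2) * ∑' k : ℕ, (ϱ ^ k / k.factorial *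
                upperIncGamma ((k : ℝ) + 1) ((2 ^ θ - 1) / (η * (1 - ϱ ^ 2)))) ^ 2))) := by
  obtain ⟨d, hd⟩ : ∃ d, M * N = d + 1 := ⟨M * N - 1, by have := Nat.mul_pos hM hN; omega⟩
  have hdR : (M : ℝ) * N = d + 1 := by exact_mod_cast hd
  have hϱ0 : 0 ≤ ϱ := hϱ ▸ norm_nonneg _
  have hσ : 0 < 1 - ϱ ^ 2 := by nlinarith
  have hρ : ‖ρ Ts‖ < 1 := hϱ ▸ hϱ_lt
  have hM' : (0 : ℝ) < M := by exact_mod_cast hM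
  have h2θ : 0 ≤ (2 : ℝ) ^ θ - 1 := sub_nonneg.2 (Real.one_le_rpow one_le_two hθ)
  set a : ℝ := M * (2 ^ θ - 1) / η with ha
  set z : ℝ := M * (2 ^ θ - 1) / (η * (1 - ϱ ^ 2)) with hz
  have ha0 : 0 ≤ a := by positivity
  have hz0 : 0 ≤ z := by positivity
  have hza : z = a / (1 - ϱ ^ 2) := by rw [ha, hz, div_div]
  set I := ostbcIMI η Ts h with hI
  set X : ℕ → Ω → ℝ := fun l ω => ∑ r, ∑ t, ‖h r t (l * Ts) ω‖ ^ 2 with hX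
  have hXm : ∀ l, Measurable (X l) := fun l => by
    have : ∀ r t, Measurable (h r t (l * Ts)) := fun r t => (hh.rayleigh r t).measurable _
    fun_prop
  have hIm : ∀ l, Measurable (I l) := fun l => by
    have : I l = fun ω => Real.logb 2 (1 + η / M * X l ω) := rfl
    rw [this]
    simp only [Real.logb]
    fun_prop
  have hclip : ∀ l ω, clip I θ l ω = 1 ↔ a ≤ X l ω := fun l ω =>
    (clip_eq_one_iff l ω).trans (le_ostbcIMI_iff hM hη l ω)
  have hlaw : ∀ l, P.map (X l) = gammaMeasure (d + 1) 1 := fun l =>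
    hh.map_power_eq_gammaMeasure hd hρ (l * Ts)
  have hlaw2 : ∀ l, 1 ≤ l → P.map (fun ω => (X l ω / (1 - ϱ ^ 2), X (l - 1) ω / (1 - ϱ ^ 2))) =
      gammaMixture d (ϱ ^ 2) := fun l hl => by
    have := hh.map_power_pair_eq_gammaMixture hd hρ (l * Ts)
    rw [← hϱ, show (l : ℝ) * Ts - Ts = (l - 1 : ℕ) * Ts by push_cast [Nat.cast_sub hl]; ring]
      at this
    exact this
  set p : ℝ := (gammaMeasure ((d : ℝ) + 1) 1).real (Set.Ici a) with hpdef
  set J : ℝ := (gammaMixture d (ϱ ^ 2)).real (Set.Ici z ×ˢ Set.Ici z) with hJdef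
  have hp : ∀ l, 1 ≤ l → P.real {ω | clip I θ l ω = 1} = p := fun l _ => by
    rw [hpdef, ← hlaw l, map_measureReal_apply (hXm l) measurableSet_Ici]
    simp only [hclip]
    rfl
  have hpairm : ∀ l, Measurable fun ω => (X l ω / (1 - ϱ ^ 2), X (l - 1) ω / (1 - ϱ ^ 2)) :=
    fun l => ((hXm l).div_const _).prodMk ((hXm (l - 1)).div_const _)
  have hJ : ∀ l, 2 ≤ l → P.real {ω | clip I θ l ω = 1 ∧ clip I θ (l - 1) ω = 1} = J := by
    intro l hl
    rw [hJdef, ← hlaw2 l (by omega), map_measureReal_apply (hpairm l)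
      (measurableSet_Ici.prod measurableSet_Ici)]
    simp only [hclip, hza]
    congr 1 with ω
    simp [div_le_div_iff_of_pos_right hσ]
  -- Here `p` is recovered as the first marginal of the mixture, from the samples `l = 1` and `l - 1
  -- = 0`; the sample at time `0` is available since `h` is defined at all real times.
  have hpJ : 0 < θ → J < p := fun hθ' => by
    have h1θ : 0 < (2 : ℝ) ^ θ - 1 := sub_pos.2 (Real.one_lt_rpow one_lt_two hθ')
    have h1 := gammaMixture_real_lt d (sq_nonneg ϱ) (by linarith) (z := z) (by positivity)
    rw [← hJdef] at h1
    rw [← hp 1 le_rfl]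
    refine h1.trans_eq ?_
    rw [← hlaw2 1 le_rfl, map_measureReal_apply (hpairm 1)
      (measurableSet_Ici.prod MeasurableSet.univ)]
    simp only [hclip, hza]
    congr 1 with ω
    simp [div_le_div_iff_of_pos_right hσ]
  have hsum := hasSum_gammaMixture_Ici d hϱ0 hϱ_lt hz0
  rw [← hJdef, ← hdR, ← hd] at hsum
  have hfac : (d.factorial : ℝ) ≠ 0 := by exact_mod_cast d.factorial_ne_zero
  have hS := (summable_mul_left_iff (a := (1 - ϱ ^ 2) ^ (M * N) / (d.factorial : ℝ))
    (by positivity)).1 hsum.summable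
  have hJS := hsum.tsum_eq
  rw [tsum_mul_left] at hJS
  have hdf : M * N - 1 = d := by omega
  have hpU : p = upperIncGamma (M * N) a / d.factorial := by
    rw [hpdef, gammaMeasure_one_real_Ici d ha0, hdR]
  have hrate : ∀ L : ℕ, 2 ≤ L → levelCrossingRate P I Ts θ L = (p - J) / Ts := by
    intro L hL
    have hL' : (L : ℝ) - 1 ≠ 0 := by
      have : (2 : ℝ) ≤ L := by exact_mod_cast hL
      linarith
    rw [levelCrossingRate, integral_downCrossings hIm hp hJ hL, mul_div_mul_left _ _ hL']
  -- The outage event is non-strict, hence not the complement of `clip = 1`; it is evaluated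
  -- directly under the gamma law.
  have hout : ∀ l, P.real {ω | I l ω ≤ θ} = lowerIncGamma (M * N) a / d.factorial := by
    intro l
    rw [hdR, ← gammaMeasure_one_real_Iic d ha0, ← hlaw l,
      map_measureReal_apply (hXm l) measurableSet_Iic]
    congr 1 with ω
    exact ostbcIMI_le_iff hM hη l ω
  have hrateS : ∀ L : ℕ, 2 ≤ L → levelCrossingRate P I Ts θ L =
      upperIncGamma (M * N) a / ((M * N - 1).factorial * Ts) -
        (1 - ϱ ^ 2) ^ (M * N) / ((M * N - 1).factorial * Ts) *
          ∑' k : ℕ, ϱ ^ (2 * k) * upperIncGamma ((k : ℝ) + M * N) z ^ 2 /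
              (k.factorial * (M * N + k - 1).factorial) := by
    intro L hL
    rw [hrate L hL, hpU, ← hJS, hdf]
    field_simp
  have hout' : 0 < θ → ∀ l L : ℕ, 1 ≤ l → 2 ≤ L →
      0 < levelCrossingRate P I Ts θ L ∧
      averageOutageDuration P I Ts θ l L / Ts =
        lowerIncGamma (M * N) a / (upperIncGamma (M * N) a - (1 - ϱ ^ 2) ^ (M * N) *
          ∑' k : ℕ, ϱ ^ (2 * k) * upperIncGamma ((k : ℝ) + M * N) z ^ 2 /
            (k.factorial * (M * N + k - 1).factorial)) := by
    intro hθ' l L _ hL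
    have hpos : 0 < p - J := sub_pos.2 (hpJ hθ')
    refine ⟨by rw [hrate L hL]; positivity, ?_⟩
    -- The denominator is `d!(p - J)`, hence nonzero; its `d!` cancels the one in the outage
    -- probability.
    have hden : upperIncGamma (M * N) a - (1 - ϱ ^ 2) ^ (M * N) *
          ∑' k : ℕ, ϱ ^ (2 * k) * upperIncGamma ((k : ℝ) + M * N) z ^ 2 /
            (k.factorial * (M * N + k - 1).factorial) = d.factorial * (p - J) := by
      rw [hpU, ← hJS]
      field_simp
    rw [averageOutageDuration, hrate L hL, hout, hden]
    field_simp
  refine ⟨hS, hrateS, ?_, ?_, hout', ?_⟩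
  · intro L hL
    have hL' : (L : ℝ) - 1 ≠ 0 := by
      have : (2 : ℝ) ≤ L := by exact_mod_cast hL
      linarith
    rw [crossingRate, integral_crossings hIm hp hJ hL, mul_div_mul_left _ _ hL', hrate L hL,
      mul_div_assoc]
  · intro l L hl hL
    rw [hrate L hL, hp l (by omega), hJ l hl]
  · intro hM1 hN1 r t
    subst hM1 hN1
    have hsiso : I = sisoIMI η Ts (h r t) := ostbcIMI_eq_sisoIMI r t
    -- For `MN = 1` both factorials in the denominator are `k!`, so each term is a perfect square.
    have hseries : (∑' k : ℕ, ϱ ^ (2 * k) * upperIncGamma ((k : ℝ) + (1 : ℕ) * (1 : ℕ)) z ^ 2 /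
        (k.factorial * (1 * 1 + k - 1).factorial)) =
        ∑' k : ℕ, (ϱ ^ k / k.factorial *
            upperIncGamma ((k : ℝ) + 1) ((2 ^ θ - 1) / (η * (1 - ϱ ^ 2)))) ^ 2 := by
      refine tsum_congr fun k => ?_
      rw [show 1 * 1 + k - 1 = k by omega, hz]
      simp only [Nat.cast_one, one_mul]
      rw [mul_pow, div_pow, ← pow_mul, mul_comm k 2]
      ring
    have ha1 : a = (2 ^ θ - 1) / η := by simp [ha]
    refine ⟨hsiso, fun L hL => ?_, fun hθ' l L hl hL => ?_⟩
    · rw [← hsiso, hrateS L hL, hseries, ha1]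
      simp [upperIncGamma_one]
    · rw [← hsiso, (hout' hθ' l L hl hL).2, hseries, ha1]
      simp [upperIncGamma_one, lowerIncGamma_one]
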